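/- Let $n\ge 1$ and let $K:\mathbb{R}^n\setminus\{0\}\to[0,\infty)$ be an even kernel with $\int_{\mathbb{R}^n}K(z)\min\{1,|z|\}\,dz<\infty$ and $K\ge 1$ in $B_2\setminus\{0\}$. Suppose that the directional derivatives $\partial_eK$ and $\partial_{ee}K$ exist on $\mathbb{R}^n\setminus\{0\}$ for every $e\in S^{n-1}$ and that $$\max\Big\{|z|\,|\partial_eK(z)|,\ |z|^2\sup_{|y-z|\le|z|/2}|\partial_{ee}K(y)|\Big\}\le K^*(z)\qquad\text{for all } z\ne 0,\ e\in S^{n-1},$$ where $K^*$ is of one of the following three types: $K^*=C_1K$ for some $C_1>0$; $K^*=C_1\,(K+\chi_{\{|z|<R_0\}})$ for some $C_1>0$, $R_0\ge 2$; or $K^*\in L^1(\mathbb{R}^n)$. (Integrable kernels $K$, for which the functional below is finite on all sets, are allowed.) For measurable $A,B\subset\mathbb{R}^n$ let $L_K(A,B)=\int_A\int_BK(x-y)\,dy\,dx\in[0,\infty]$. For measurable $\Omega,E\subset\mathbb{R}^n$, with $\mathcal{C}$ denoting the complement in $\mathbb{R}^n$, let $$P_{K,\Omega}(E)=L_K(E\cap\Omega,\mathcal{C}E\cap\Omega)+L_K(E\cap\Omega,\mathcal{C}E\setminus\Omega)+L_K(E\setminus\Omega,\mathcal{C}E\cap\Omega).$$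 **Theorem (existence of minimizers).** Let $\Omega\subset\mathbb{R}^n$ be a bounded open set (connected or not) with Lipschitz boundary, that is, near each of its boundary points $\Omega$ is, in suitable orthonormal coordinates, the strict epigraph of a Lipschitz function. Let $E_0\subset\mathcal{C}\Omega$ be Lebesgue measurable. Then there exists a Lebesgue measurable set $E\subset\mathbb{R}^n$ with $E\cap\mathcal{C}\Omega=E_0$ that is a minimizer for $P_{K,\Omega}$: that is, $P_{K,\Omega}(E)<\infty$ and $P_{K,\Omega}(E)\le P_{K,\Omega}(F)$ for every Lebesgue measurable $F\subset\mathbb{R}^n$ with $F\setminus\Omega=E\setminus\Omega$. -/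

import Mathlib

open MeasureTheory
open scoped NNReal ENNReal

namespace NonlocalPerimeter

/-- The boundary of `Ω ⊆ ℝⁿ` is Lipschitz: near each of its points, `Ω` is, in suitable
orthonormal coordinates, the strict epigraph of a Lipschitz function. Here `ν` is the vertical
direction, `inner ℝ ν x` the height of `x` and `x - inner ℝ ν x • ν` its horizontal part. Only the
values of `g` on the hyperplane `ν^⊥` matter, and every Lipschitz function on `ν^⊥` extends to a
Lipschitz function on `ℝⁿ` (compose it with the orthogonal projection). -/
def HasLipschitzBoundary {n : ℕ} (Ω : Set (EuclideanSpace ℝ (Fin n))) : Prop :=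
  ∀ x₀ ∈ frontier Ω, ∃ (ν : EuclideanSpace ℝ (Fin n)) (r : ℝ) (L : ℝ≥0)
    (g : EuclideanSpace ℝ (Fin n) → ℝ),
    ‖ν‖ = 1 ∧ 0 < r ∧ LipschitzWith L g ∧
      Ω ∩ Metric.ball x₀ r =
        {x | g (x - (inner ℝ ν x) • ν) < inner ℝ ν x} ∩ Metric.ball x₀ r

/-- `|z| |∂_e K(z)| ≤ K*(z)` and `|z|² sup_{|y - z| ≤ |z|/2} |∂_{ee} K(y)| ≤ K*(z)` for all `z ≠ 0`
and all unit vectors `e`, the derivatives `∂_e K` and `∂_{ee} K` existing away from the origin. -/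
structure DerivBound {n : ℕ} (K Kstar : EuclideanSpace ℝ (Fin n) → ℝ) : Prop where
  /-- `∂_e K` exists away from the origin. -/
  lineDiff : ∀ e z : EuclideanSpace ℝ (Fin n), ‖e‖ = 1 → z ≠ 0 → LineDifferentiableAt ℝ K z e
  /-- `∂_{ee} K` exists away from the origin. -/
  lineDiff_two : ∀ e z : EuclideanSpace ℝ (Fin n), ‖e‖ = 1 → z ≠ 0 →
    LineDifferentiableAt ℝ (fun w => lineDeriv ℝ K w e) z e
  first : ∀ e z : EuclideanSpace ℝ (Fin n), ‖e‖ = 1 → z ≠ 0 →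
    ‖z‖ * |lineDeriv ℝ K z e| ≤ Kstar z
  second : ∀ e z y : EuclideanSpace ℝ (Fin n), ‖e‖ = 1 → z ≠ 0 → ‖y - z‖ ≤ ‖z‖ / 2 →
    ‖z‖ ^ 2 * |lineDeriv ℝ (fun w => lineDeriv ℝ K w e) y e| ≤ Kstar z

/-- The three types of control kernel `K*`: `K* = C₁ K`, or `K* = C₁ (K + χ_{|z| < R₀})` with
`R₀ ≥ 2`, or `K* ∈ L¹(ℝⁿ)`. -/
def IsControlKernel {n : ℕ} (K Kstar : EuclideanSpace ℝ (Fin n) → ℝ) : Prop :=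
  (∃ C₁ : ℝ, 0 < C₁ ∧ ∀ z, z ≠ 0 → Kstar z = C₁ * K z) ∨
  (∃ C₁ R₀ : ℝ, 0 < C₁ ∧ 2 ≤ R₀ ∧ ∀ z, z ≠ 0 →
    Kstar z = C₁ * (K z + Set.indicator (Metric.ball 0 R₀) (fun _ => (1 : ℝ)) z)) ∨
  Integrable Kstar volume

/-- The general hypotheses on the interaction kernel. Since `K` may be singular at the origin,
its value there is irrelevant. -/
structure IsAdmissibleKernel {n : ℕ} (K : EuclideanSpace ℝ (Fin n) → ℝ) : Prop where
  nonneg : ∀ z, z ≠ 0 → 0 ≤ K z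
  even : ∀ z, K (-z) = K z
  /-- `∫ K(z) min {1, |z|} dz < ∞`. -/
  integrable : Integrable (fun z => K z * min 1 ‖z‖) volume
  /-- `K ≥ 1` in the ball `B₂`. -/
  one_le : ∀ z, z ≠ 0 → ‖z‖ < 2 → 1 ≤ K z
  derivBound : ∃ Kstar : EuclideanSpace ℝ (Fin n) → ℝ,
    IsControlKernel K Kstar ∧ DerivBound K Kstar

/-- The interaction `L_K(A, B) = ∫_A ∫_B K(x - y) dy dx ∈ [0, ∞]`. -/
noncomputable def interaction {n : ℕ} (K : EuclideanSpace ℝ (Fin n) → ℝ)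
    (A B : Set (EuclideanSpace ℝ (Fin n))) : ℝ≥0∞ :=
  ∫⁻ x in A, ∫⁻ y in B, ENNReal.ofReal (K (x - y))

/-- The `K`-perimeter `P_{K,Ω}(E) ∈ [0, ∞]` of `E` inside `Ω`. -/
noncomputable def perimeter {n : ℕ} (K : EuclideanSpace ℝ (Fin n) → ℝ)
    (Ω E : Set (EuclideanSpace ℝ (Fin n))) : ℝ≥0∞ :=
  interaction K (E ∩ Ω) (Eᶜ ∩ Ω) + interaction K (E ∩ Ω) (Eᶜ \ Ω)
    + interaction K (E \ Ω) (Eᶜ ∩ Ω)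

/-- `E` is a minimizer for `P_{K,Ω}`: it is Lebesgue measurable, its energy is finite, and it has
the least energy among all Lebesgue measurable sets that coincide with it outside `Ω`. -/
structure IsMinimizer {n : ℕ} (K : EuclideanSpace ℝ (Fin n) → ℝ)
    (Ω E : Set (EuclideanSpace ℝ (Fin n))) : Prop where
  measurable : NullMeasurableSet E volume
  finite : perimeter K Ω E < ∞
  le : ∀ F : Set (EuclideanSpace ℝ (Fin n)), NullMeasurableSet F volume →
    F \ Ω = E \ Ω → perimeter K Ω E ≤ perimeter K Ω F

end NonlocalPerimeter

open Filter Topology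

namespace NonlocalPerimeter

/-! The perimeter of `E` is the value at its indicator of the functional `∬ w(x, y) (u(x) - u(y))⁺`,
which is convex in `u` and lower semicontinuous under a.e. convergence. No compactness of sets of
bounded energy is available when `K` is integrable; convexity replaces it. In `L²(Ω)`, with exterior
datum `E₀`, the sublevel sets at `I + 1/(m+1)`, where `I` is the infimum over sets, are nested,
midpoint convex and contain indicators of bounded norm. Points of almost least norm in them form a
Cauchy sequence (`exists_cauchySeq_mem`), and Fatou's lemma bounds the energy of the limit function
by `I`. By the coarea inequality (`exists_superlevel_weightedVariation_le`) some superlevel set does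
no worse, so it is a minimizer.

Finiteness follows from the competitor `E₀`, whose energy is at most `L_K(Ωᶜ, Ω)`. The Lipschitz
boundary gives `|Ω \ (Ω + z)| ≤ C min(1, |z|)`, which matches the integrability of `K`. -/

/-! ### Almost shortest vectors in nested midpoint-convex sets -/

theorem exists_cauchySeq_mem {H : Type*} [NormedAddCommGroup H] [InnerProductSpace ℝ H]
    (C : ℕ → Set H) (hanti : Antitone C)
    (hmid : ∀ m, ∀ x ∈ C m, ∀ y ∈ C m, (1 / 2 : ℝ) • (x + y) ∈ C m)
    (R : ℝ) (hR : ∀ m, ∃ x ∈ C m, ‖x‖ ≤ R) :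
    ∃ v : ℕ → H, (∀ m, v m ∈ C m) ∧ CauchySeq v := by
  set d : ℕ → ℝ := fun m => sInf ((fun x => ‖x‖ ^ 2) '' C m) with hd
  have hbdd : ∀ m, BddBelow ((fun x => ‖x‖ ^ 2) '' C m) := fun m =>
    ⟨0, by rintro _ ⟨x, -, rfl⟩; positivity⟩
  have hne : ∀ m, ((fun x => ‖x‖ ^ 2) '' C m).Nonempty := fun m => by
    obtain ⟨x, hx, -⟩ := hR m
    exact ⟨_, x, hx, rfl⟩
  have hle : ∀ m, ∀ x ∈ C m, d m ≤ ‖x‖ ^ 2 := fun m x hx => csInf_le (hbdd m) ⟨x, hx, rfl⟩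
  have hmono : Monotone d := fun m k hmk =>
    csInf_le_csInf (hbdd m) (hne k) (Set.image_mono (hanti hmk))
  have hdR : ∀ m, d m ≤ R ^ 2 := fun m => by
    obtain ⟨x, hx, hxR⟩ := hR m
    exact (hle m x hx).trans (by gcongr)
  have hbd : BddAbove (Set.range d) := ⟨R ^ 2, by rintro _ ⟨m, rfl⟩; exact hdR m⟩
  have hlim : Tendsto d atTop (𝓝 (⨆ m, d m)) := tendsto_atTop_ciSup hmono hbd
  have hsup : ∀ m, d m ≤ ⨆ m, d m := fun m => le_ciSup hbd m
  have hex : ∀ m : ℕ, ∃ x ∈ C m, ‖x‖ ^ 2 < d m + 1 / ((m : ℝ) + 1) := fun m => by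
    obtain ⟨_, ⟨x, hx, rfl⟩, h⟩ := exists_lt_of_csInf_lt (hne m)
      (show sInf _ < d m + 1 / ((m : ℝ) + 1) by
        have : 0 < 1 / ((m : ℝ) + 1) := by positivity
        linarith)
    exact ⟨x, hx, h⟩
  choose v hv hvd using hex
  -- For `m, k ≥ N` the midpoint lies in `C N`, so `‖v m + v k‖² ≥ 4 d N`; the parallelogram law
  -- then bounds `‖v m - v k‖²` by the radicand.
  refine ⟨v, hv, cauchySeq_of_le_tendsto_0
    (fun N => √(4 * ((⨆ m, d m) - d N) + 4 * (1 / ((N : ℝ) + 1)))) ?_ ?_⟩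
  · intro m k N hm hk
    rw [dist_eq_norm]
    apply Real.le_sqrt_of_sq_le
    have h1 := hle N _ (hmid N _ (hanti hm (hv m)) _ (hanti hk (hv k)))
    rw [norm_smul, mul_pow] at h1
    norm_num at h1
    have h2 := parallelogram_law_with_norm ℝ (v m) (v k)
    have e1 : 1 / ((m : ℝ) + 1) ≤ 1 / ((N : ℝ) + 1) := by gcongr
    have e2 : 1 / ((k : ℝ) + 1) ≤ 1 / ((N : ℝ) + 1) := by gcongr
    have := hvd m
    have := hvd k
    have := hsup m
    have := hsup k
    nlinarith
  · have h := (((tendsto_const_nhds (x := ⨆ m, d m)).sub hlim).const_mul (4 : ℝ)).add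
      ((tendsto_one_div_add_atTop_nhds_zero_nat (𝕜 := ℝ)).const_mul 4)
    simpa using h.sqrt

/-! ### Lipschitz domains: measure of `Ω` minus its translates -/

variable {n : ℕ}

local notation "V" => EuclideanSpace ℝ (Fin n)

/-- A graph strip of height `h` inside a ball has measure `O(h)`: its translates along the vertical
direction are disjoint. -/
theorem volume_graph_strip_le (ν x₀ : EuclideanSpace ℝ (Fin n)) (hν : ‖ν‖ = 1) (r : ℝ)
    (g : EuclideanSpace ℝ (Fin n) → ℝ) (hg : Continuous g)
    (h : ℝ) (h0 : 0 < h) (h1 : h ≤ 1) :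
    volume ({x | g (x - (inner ℝ ν x) • ν) < inner ℝ ν x ∧
      inner ℝ ν x ≤ g (x - (inner ℝ ν x) • ν) + h} ∩ Metric.ball x₀ r) ≤
      2 * ENNReal.ofReal h * volume (Metric.ball x₀ (r + 1)) := by
  set S := {x | g (x - (inner ℝ ν x) • ν) < inner ℝ ν x ∧
      inner ℝ ν x ≤ g (x - (inner ℝ ν x) • ν) + h} ∩ Metric.ball x₀ r with hS
  have hmeas : MeasurableSet S := by
    have h1 : Continuous fun x : V => g (x - (inner ℝ ν x) • ν) := by fun_prop
    have h2 : Continuous fun x : V => (inner ℝ ν x : ℝ) := by fun_prop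
    exact ((isOpen_lt h1 h2).measurableSet.inter
      (isClosed_le h2 (h1.add continuous_const)).measurableSet).inter measurableSet_ball
  -- `N` translates by multiples of `h` move the strip by at most 1, hence the radius `r + 1`; `h ≤
  -- 1` gives `N ≥ 1/(2h)`, hence the factor 2.
  set N := ⌊1 / h⌋₊ with hN
  have hNh : (N : ℝ) * h ≤ 1 := by
    have := Nat.floor_le (show 0 ≤ 1 / h by positivity)
    rwa [le_div_iff₀ h0] at this
  have hN2 : 1 ≤ 2 * h * N := by
    have h3 := Nat.lt_floor_add_one (1 / h)
    have h4 : (1 : ℝ) ≤ N := by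
      exact_mod_cast Nat.le_floor (by rw [Nat.cast_one, le_div_iff₀ h0]; linarith)
    rw [div_lt_iff₀ h0] at h3
    nlinarith
  have hinner : ∀ (t : ℝ) (x : V), inner ℝ ν (x - t • ν) = inner ℝ ν x - t := by
    intro t x
    rw [inner_sub_right, inner_smul_right, real_inner_self_eq_norm_sq, hν]; ring
  have hhor : ∀ (t : ℝ) (x : V), (x - t • ν) - (inner ℝ ν (x - t • ν)) • ν =
      x - (inner ℝ ν x) • ν := by
    intro t x
    rw [hinner]; module
  have hT : ∀ k : ℕ, MeasurableSet ((fun x : V => x - ((k : ℝ) * h) • ν) ⁻¹' S) := fun k =>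
    hmeas.preimage (by fun_prop)
  have hvol : ∀ k : ℕ, volume ((fun x : V => x - ((k : ℝ) * h) • ν) ⁻¹' S) = volume S := fun k => by
    simpa only [sub_eq_add_neg] using measure_preimage_add_right volume (-(((k : ℝ) * h) • ν)) S
  have hdisj : Pairwise (Function.onFun Disjoint
      (fun k : ℕ => (fun x : V => x - ((k : ℝ) * h) • ν) ⁻¹' S)) := by
    have key : ∀ k l : ℕ, k < l → Disjoint ((fun x : V => x - ((k : ℝ) * h) • ν) ⁻¹' S)
        ((fun x : V => x - ((l : ℝ) * h) • ν) ⁻¹' S) := by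
      intro k l hkl
      rw [Set.disjoint_left]
      rintro x ⟨⟨-, hx⟩, -⟩ ⟨⟨hy, -⟩, -⟩
      rw [hhor, hinner] at hx hy
      have : (k : ℝ) + 1 ≤ l := by exact_mod_cast hkl
      nlinarith
    intro k l hkl
    rcases lt_or_gt_of_ne hkl with h' | h'
    · exact key k l h'
    · exact (key l k h').symm
  have hsub : (⋃ k ∈ Finset.range N, (fun x : V => x - ((k : ℝ) * h) • ν) ⁻¹' S) ⊆
      Metric.ball x₀ (r + 1) := by
    intro x hx
    simp only [Set.mem_iUnion, Finset.mem_range] at hx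
    obtain ⟨k, hk, -, hx⟩ := hx
    rw [Metric.mem_ball] at hx ⊢
    have h5 : dist x (x - ((k : ℝ) * h) • ν) ≤ 1 := by
      rw [dist_eq_norm, sub_sub_cancel, norm_smul, hν, mul_one, Real.norm_of_nonneg (by positivity)]
      have : (k : ℝ) ≤ N := by exact_mod_cast hk.le
      nlinarith
    linarith [dist_triangle x (x - ((k : ℝ) * h) • ν) x₀]
  have hNS : (N : ℝ≥0∞) * volume S ≤ volume (Metric.ball x₀ (r + 1)) := by
    refine le_trans (le_of_eq ?_) (measure_mono hsub)
    rw [measure_biUnion_finset (fun k _ l _ hkl => hdisj hkl) (fun k _ => hT k)]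
    simp [hvol]
  calc volume S = 1 * volume S := (one_mul _).symm
    _ ≤ ENNReal.ofReal (2 * h * N) * volume S := by
        gcongr; rwa [← ENNReal.ofReal_one, ENNReal.ofReal_le_ofReal_iff (by positivity)]
    _ = 2 * ENNReal.ofReal h * (N * volume S) := by
        rw [ENNReal.ofReal_mul (by positivity), ENNReal.ofReal_mul (by positivity)]
        simp [mul_assoc]
    _ ≤ _ := by gcongr

theorem exists_mem_frontier_dist_le {Ω : Set (EuclideanSpace ℝ (Fin n))}
    {x y : EuclideanSpace ℝ (Fin n)} (hx : x ∈ Ω) (hy : y ∉ Ω) :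
    ∃ p ∈ frontier Ω, dist x p ≤ dist x y := by
  obtain ⟨p, hp, hpf⟩ : ∃ p ∈ segment ℝ x y, p ∈ frontier Ω := by
    by_contra! hcon
    have hint : ∀ q ∈ segment ℝ x y, q ∈ interior Ω ∨ q ∈ (closure Ω)ᶜ := fun q hq => by
      by_contra! h
      exact hcon q hq ⟨by simpa using h.2, h.1⟩
    obtain ⟨q, -, hq1, hq2⟩ := (convex_segment x y).isPreconnected (interior Ω) (closure Ω)ᶜ
      isOpen_interior isClosed_closure.isOpen_compl hint
      ⟨x, left_mem_segment ℝ x y, (hint x (left_mem_segment ℝ x y)).resolve_right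
        fun h => h (subset_closure hx)⟩
      ⟨y, right_mem_segment ℝ x y, (hint y (right_mem_segment ℝ x y)).resolve_left
        fun h => hy (interior_subset h)⟩
    exact hq2 (subset_closure (interior_subset hq1))
  refine ⟨p, hpf, ?_⟩
  have := dist_add_dist_of_mem_segment hp
  linarith [dist_nonneg (x := p) (y := y)]

/-- Near a Lipschitz boundary, `Ω` and its translate by `z` differ by a set of measure `O(|z|)`. -/
theorem volume_diff_translate_ball_le {Ω : Set (EuclideanSpace ℝ (Fin n))}
    (hlip : HasLipschitzBoundary Ω) {x₀ : EuclideanSpace ℝ (Fin n)} (hx₀ : x₀ ∈ frontier Ω) :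
    ∃ (ρ : ℝ) (C : ℝ≥0∞), 0 < ρ ∧ C ≠ ∞ ∧ ∀ z : EuclideanSpace ℝ (Fin n), ‖z‖ ≤ ρ →
      volume ({x | x ∈ Ω ∧ x - z ∉ Ω} ∩ Metric.ball x₀ (2 * ρ)) ≤ C * ENNReal.ofReal ‖z‖ := by
  obtain ⟨ν, r, L, g, hν, hr, hg, hΩ⟩ := hlip x₀ hx₀
  have hL : (0 : ℝ) ≤ L := L.2
  -- Translation by `z` changes the height by at most `|z|` and the horizontal part by at most
  -- `2|z|`, hence `g` by at most `2L|z|`. Below, `r / 3` keeps both points in the chart and `1 / M`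
  -- keeps the strip height at most 1.
  set M : ℝ := 1 + 2 * L with hM
  have hM0 : 0 < M := by positivity
  set ρ := min (r / 3) (1 / M) with hρ
  have hρr : ρ ≤ r / 3 := min_le_left _ _
  have hρM : ρ ≤ 1 / M := min_le_right _ _
  refine ⟨ρ, 2 * ENNReal.ofReal M * volume (Metric.ball x₀ (r + 1)), by positivity,
    ENNReal.mul_ne_top (by simp [ENNReal.mul_eq_top]) measure_ball_lt_top.ne, fun z hz => ?_⟩
  rcases eq_or_ne z 0 with rfl | hz0
  · simp
  have hz0' : 0 < ‖z‖ := norm_pos_iff.2 hz0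
  have hMz : M * ‖z‖ ≤ 1 := by
    have := hz.trans hρM
    rwa [le_div_iff₀ hM0, mul_comm] at this
  refine (measure_mono ?_).trans ((volume_graph_strip_le ν x₀ hν r g hg.continuous (M * ‖z‖)
    (by positivity) hMz).trans (le_of_eq ?_))
  · rintro x ⟨⟨hx, hxz⟩, hxb⟩
    rw [Metric.mem_ball] at hxb
    have hb : x ∈ Metric.ball x₀ r := by rw [Metric.mem_ball]; linarith
    have hbz : x - z ∈ Metric.ball x₀ r := by
      rw [Metric.mem_ball]
      have : dist (x - z) x = ‖z‖ := by rw [dist_eq_norm]; simp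
      linarith [dist_triangle (x - z) x x₀]
    have h1 : x ∈ {x | g (x - (inner ℝ ν x) • ν) < inner ℝ ν x} ∩ Metric.ball x₀ r :=
      hΩ ▸ ⟨hx, hb⟩
    have h2 : ¬ g ((x - z) - (inner ℝ ν (x - z)) • ν) < inner ℝ ν (x - z) := fun h => by
      have : x - z ∈ Ω ∩ Metric.ball x₀ r := by rw [hΩ]; exact ⟨h, hbz⟩
      exact hxz this.1
    refine ⟨⟨h1.1, ?_⟩, hb⟩
    rw [not_lt] at h2
    have h3 : |inner ℝ ν z| ≤ ‖z‖ := by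
      simpa [hν] using abs_real_inner_le_norm ν z
    have h4 := hg.dist_le_mul ((x - z) - (inner ℝ ν (x - z)) • ν) (x - (inner ℝ ν x) • ν)
    have h5 : dist ((x - z) - (inner ℝ ν (x - z)) • ν) (x - (inner ℝ ν x) • ν) ≤ 2 * ‖z‖ := by
      rw [dist_eq_norm]
      have : (x - z) - (inner ℝ ν (x - z)) • ν - (x - (inner ℝ ν x) • ν) =
          (inner ℝ ν z) • ν - z := by
        rw [inner_sub_right]; module
      rw [this]
      refine (norm_sub_le _ _).trans ?_
      rw [norm_smul, hν, Real.norm_eq_abs]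
      linarith
    rw [Real.dist_eq] at h4
    have h6 := (abs_le.1 h4).2
    rw [inner_sub_right] at h2 h6
    have h7 := (abs_le.1 h3).2
    have h8 : (L : ℝ) * dist ((x - z) - (inner ℝ ν (x - z)) • ν) (x - (inner ℝ ν x) • ν) ≤
      L * (2 * ‖z‖) := by gcongr
    rw [inner_sub_right] at h8
    rw [hM]
    linarith
  · rw [ENNReal.ofReal_mul hM0.le]; ring

/-- Finitely many charts cover the compact frontier. For small `z`, a point leaving `Ω` under
translation is within `|z|` of the frontier, hence in a doubled chart ball; for large `z` the
measure of `Ω` is enough. -/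
theorem volume_diff_translate_le {Ω : Set (EuclideanSpace ℝ (Fin n))}
    (hbdd : Bornology.IsBounded Ω) (hlip : HasLipschitzBoundary Ω) :
    ∃ C : ℝ≥0∞, C ≠ ∞ ∧ ∀ z : EuclideanSpace ℝ (Fin n),
      volume {x | x ∈ Ω ∧ x - z ∉ Ω} ≤ C * ENNReal.ofReal (min 1 ‖z‖) := by
  choose! ρ C hρ hC hle using fun x₀ (hx₀ : x₀ ∈ frontier Ω) =>
    volume_diff_translate_ball_le hlip hx₀
  have hcomp : IsCompact (frontier Ω) :=
    Metric.isCompact_of_isClosed_isBounded isClosed_frontier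
      (hbdd.closure.subset frontier_subset_closure)
  obtain ⟨t, htΩ, hcov⟩ := hcomp.elim_nhds_subcover (fun x => Metric.ball x (ρ x))
    (fun x hx => Metric.ball_mem_nhds x (hρ x hx))
  obtain ⟨δ, hδ0, hδ⟩ : ∃ δ : ℝ, 0 < δ ∧ ∀ x ∈ t, δ ≤ ρ x := by
    rcases t.eq_empty_or_nonempty with rfl | hne
    · exact ⟨1, one_pos, by simp⟩
    · obtain ⟨x, hx, hmin⟩ := t.exists_min_image ρ hne
      exact ⟨ρ x, hρ x (htΩ x hx), hmin⟩
  set δ' := min δ 1 with hδ'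
  have hδ'0 : 0 < δ' := lt_min hδ0 one_pos
  have hfin : volume Ω ≠ ∞ := hbdd.measure_lt_top.ne
  refine ⟨(∑ x ∈ t, C x) + volume Ω / ENNReal.ofReal δ', ?_, fun z => ?_⟩
  · refine ENNReal.add_ne_top.2 ⟨?_, ENNReal.div_ne_top hfin (by simpa using hδ'0)⟩
    exact (ENNReal.sum_lt_top.2 fun x hx => (hC x (htΩ x hx)).lt_top).ne
  rcases le_or_gt ‖z‖ δ' with hz | hz
  · have hz1 : ‖z‖ ≤ 1 := hz.trans (min_le_right _ _)
    rw [min_eq_right hz1]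
    refine le_trans ?_ (mul_le_mul_left (le_add_of_nonneg_right zero_le) _)
    rw [Finset.sum_mul]
    refine le_trans (measure_mono (t := ⋃ p ∈ t,
      {x | x ∈ Ω ∧ x - z ∉ Ω} ∩ Metric.ball p (2 * ρ p)) ?_) ?_
    · rintro x ⟨hx, hxz⟩
      obtain ⟨p, hp, hxp⟩ := exists_mem_frontier_dist_le hx hxz
      obtain ⟨q, hq, hpq⟩ := Set.mem_iUnion₂.1 (hcov hp)
      refine Set.mem_iUnion₂.2 ⟨q, hq, ⟨hx, hxz⟩, ?_⟩
      rw [Metric.mem_ball] at hpq ⊢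
      have h1 : dist x (x - z) = ‖z‖ := by rw [dist_eq_norm]; simp
      have h2 : ‖z‖ ≤ ρ q := (hz.trans (min_le_left _ _)).trans (hδ q hq)
      linarith [dist_triangle x p q]
    · refine (measure_biUnion_finset_le _ _).trans (Finset.sum_le_sum fun q hq => ?_)
      exact hle q (htΩ q hq) z ((hz.trans (min_le_left _ _)).trans (hδ q hq))
  · refine le_trans (measure_mono fun x hx => hx.1) ?_
    have h1 : ENNReal.ofReal δ' ≤ ENNReal.ofReal (min 1 ‖z‖) :=
      ENNReal.ofReal_le_ofReal (le_min (min_le_right _ _) hz.le)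
    calc volume Ω = volume Ω / ENNReal.ofReal δ' * ENNReal.ofReal δ' :=
          (ENNReal.div_mul_cancel (by simpa using hδ'0) ENNReal.ofReal_ne_top).symm
      _ ≤ _ := by gcongr; exact le_add_self

/-! ### Convexity, lower semicontinuity and coarea for the weighted variation -/

section WeightedVariation

variable {α : Type*} [MeasurableSpace α]

/-- The one-sided weighted variation `∬ w(x, y) (u(x) - u(y))⁺`, the convex extension to functions
of a perimeter functional. -/
noncomputable def weightedVariation (μ : Measure α) (w : α × α → ℝ≥0∞) (u : α → ℝ) : ℝ≥0∞ :=
  ∫⁻ p, w p * ENNReal.ofReal (u p.1 - u p.2) ∂(μ.prod μ)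

variable {μ : Measure α} {w : α × α → ℝ≥0∞}

theorem weightedVariation_congr {u v : α → ℝ} (h : u =ᵐ[μ] v) :
    weightedVariation μ w u = weightedVariation μ w v := by
  refine lintegral_congr_ae ?_
  filter_upwards [Measure.quasiMeasurePreserving_fst.ae h,
    Measure.quasiMeasurePreserving_snd.ae h] with p h1 h2
  rw [h1, h2]

theorem aemeasurable_weightedVariation (hw : AEMeasurable w (μ.prod μ)) {u : α → ℝ}
    (hu : AEMeasurable u μ) :
    AEMeasurable (fun p : α × α => w p * ENNReal.ofReal (u p.1 - u p.2)) (μ.prod μ) :=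
  hw.mul (hu.comp_fst.sub hu.comp_snd).ennreal_ofReal

/-- The positive part is subadditive and positively homogeneous. -/
theorem weightedVariation_midpoint_le (hw : AEMeasurable w (μ.prod μ)) {u v : α → ℝ}
    (hu : AEMeasurable u μ) (c : ℝ≥0∞)
    (huc : weightedVariation μ w u ≤ c) (hvc : weightedVariation μ w v ≤ c) :
    weightedVariation μ w (fun x => 1 / 2 * (u x + v x)) ≤ c := by
  have h2 : ENNReal.ofReal (1 / 2) * (c + c) = c := by
    rw [← two_mul, ← mul_assoc]
    have : ENNReal.ofReal (1 / 2) * 2 = 1 := by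
      rw [show (2 : ℝ≥0∞) = ENNReal.ofReal 2 by simp, ← ENNReal.ofReal_mul (by norm_num)]
      norm_num
    rw [this, one_mul]
  refine le_trans ?_ ((mul_le_mul_right (add_le_add huc hvc) (ENNReal.ofReal (1 / 2))).trans_eq h2)
  unfold weightedVariation
  rw [← lintegral_add_left' (aemeasurable_weightedVariation hw hu),
    ← lintegral_const_mul' _ _ ENNReal.ofReal_ne_top]
  refine lintegral_mono fun p => ?_
  rw [← mul_add, mul_left_comm]
  gcongr
  have : 1 / 2 * (u p.1 + v p.1) - 1 / 2 * (u p.2 + v p.2) =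
      1 / 2 * ((u p.1 - u p.2) + (v p.1 - v p.2)) := by ring
  rw [this, ENNReal.ofReal_mul (by norm_num)]
  gcongr
  exact ENNReal.ofReal_add_le

theorem weightedVariation_le_of_tendsto_ae (hw : AEMeasurable w (μ.prod μ)) {u : ℕ → α → ℝ}
    {v : α → ℝ} (hu : ∀ k, AEMeasurable (u k) μ)
    (hlim : ∀ᵐ x ∂μ, Tendsto (fun k => u k x) atTop (𝓝 (v x))) {c : ℕ → ℝ≥0∞} {c₀ : ℝ≥0∞}
    (hc : ∀ k, weightedVariation μ w (u k) ≤ c k) (hc₀ : Tendsto c atTop (𝓝 c₀)) :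
    weightedVariation μ w v ≤ c₀ := by
  calc weightedVariation μ w v
      ≤ ∫⁻ p, liminf (fun k => w p * ENNReal.ofReal (u k p.1 - u k p.2)) atTop ∂(μ.prod μ) := by
        refine lintegral_mono_ae ?_
        filter_upwards [Measure.quasiMeasurePreserving_fst.ae hlim,
          Measure.quasiMeasurePreserving_snd.ae hlim] with p h1 h2
        have h3 : Tendsto (fun k => ENNReal.ofReal (u k p.1 - u k p.2)) atTop
            (𝓝 (ENNReal.ofReal (v p.1 - v p.2))) :=
          (ENNReal.continuous_ofReal.tendsto _).comp (h1.sub h2)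
        rw [← h3.liminf_eq]
        exact ENNReal.le_liminf_mul.trans' (by simp)
    _ ≤ liminf (fun k => weightedVariation μ w (u k)) atTop :=
        lintegral_liminf_le' fun k => aemeasurable_weightedVariation hw (hu k)
    _ ≤ liminf c atTop := liminf_le_liminf (Eventually.of_forall hc)
    _ = c₀ := hc₀.liminf_eq

variable [SFinite μ]

/-- Some superlevel set of `u` has at most the variation of `u`, by the coarea inequality. -/
theorem exists_superlevel_weightedVariation_le (hw : AEMeasurable w (μ.prod μ)) {u : α → ℝ}
    (hu : AEMeasurable u μ) :
    ∃ t ∈ Set.Ioo (0 : ℝ) 1,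
      weightedVariation μ w ({x | t < u x}.indicator 1) ≤ weightedVariation μ w u := by
  set P : Measure ℝ := volume.restrict (Set.Ioo 0 1) with hP
  have : IsProbabilityMeasure P := ⟨by simp [hP]⟩
  -- The levels `t` that separate the pair form an interval of length `(u(x) - u(y))⁺`, so averaging
  -- over `t ∈ (0, 1)` gives at most the variation of `u`.
  have hind : ∀ (t : ℝ) (p : α × α),
      ENNReal.ofReal ({x | t < u x}.indicator (1 : α → ℝ) p.1 - {x | t < u x}.indicator 1 p.2) =
      (Set.Ico (u p.2) (u p.1)).indicator 1 t := by
    intro t p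
    by_cases h1 : t < u p.1 <;> by_cases h2 : t < u p.2 <;>
      simp [Set.indicator, h1, h2, not_le, le_of_not_gt]
  have hmeas : AEMeasurable (fun q : ℝ × (α × α) =>
      w q.2 * (Set.Ico (u q.2.2) (u q.2.1)).indicator 1 q.1) (P.prod (μ.prod μ)) := by
    refine hw.comp_snd.mul ?_
    have h1 : AEMeasurable (fun q : ℝ × (α × α) => u q.2.1) (P.prod (μ.prod μ)) :=
      hu.comp_fst.comp_snd
    have h2 : AEMeasurable (fun q : ℝ × (α × α) => u q.2.2) (P.prod (μ.prod μ)) :=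
      hu.comp_snd.comp_snd
    have h3 : AEMeasurable (fun q : ℝ × (α × α) => q.1) (P.prod (μ.prod μ)) :=
      measurable_fst.aemeasurable
    have h4 := (nullMeasurableSet_le h2 h3).inter (nullMeasurableSet_lt h3 h1)
    have h5 := (aemeasurable_indicator_const_iff (μ := P.prod (μ.prod μ)) (1 : ℝ≥0∞)).2 h4
    exact h5
  have key : ∫⁻ t, weightedVariation μ w ({x | t < u x}.indicator 1) ∂P ≤
      weightedVariation μ w u := by
    unfold weightedVariation
    simp_rw [hind]
    rw [lintegral_lintegral_swap hmeas]
    refine lintegral_mono fun p => ?_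
    dsimp only
    rw [lintegral_const_mul _ (measurable_one.indicator measurableSet_Ico),
      lintegral_indicator_one measurableSet_Ico]
    gcongr
    exact (Measure.restrict_apply_le _ _).trans_eq Real.volume_Ico
  have hJ : AEMeasurable (fun t => weightedVariation μ w ({x | t < u x}.indicator 1)) P := by
    unfold weightedVariation
    simp_rw [hind]
    exact hmeas.lintegral_prod_right'
  obtain ⟨t, ht, h⟩ := exists_notMem_null_le_lintegral hJ
    (show P (Set.Ioo 0 1)ᶜ = 0 by rw [hP, Measure.restrict_apply measurableSet_Ioo.compl]; simp)
  exact ⟨t, by simpa using ht, h.trans key⟩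

theorem exists_minimizer_weightedVariation (hw : AEMeasurable w (μ.prod μ)) {Ω E₀ : Set α}
    (hΩ : MeasurableSet Ω) (hΩfin : μ Ω < ∞) (hE₀ : E₀ ⊆ Ωᶜ) (hE₀m : NullMeasurableSet E₀ μ) :
    ∃ E : Set α, NullMeasurableSet E μ ∧ E ∩ Ωᶜ = E₀ ∧
      ∀ F : Set α, NullMeasurableSet F μ → F ∩ Ωᶜ = E₀ →
        weightedVariation μ w (E.indicator 1) ≤ weightedVariation μ w (F.indicator 1) := by
  set I : ℝ≥0∞ := ⨅ F : {F : Set α // NullMeasurableSet F μ ∧ F ∩ Ωᶜ = E₀},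
    weightedVariation μ w (F.1.indicator 1) with hI
  have hIle : ∀ F : Set α, NullMeasurableSet F μ → F ∩ Ωᶜ = E₀ →
      I ≤ weightedVariation μ w (F.indicator 1) := fun F h1 h2 =>
    iInf_le (fun F : {F : Set α // NullMeasurableSet F μ ∧ F ∩ Ωᶜ = E₀} =>
      weightedVariation μ w (F.1.indicator 1)) ⟨F, h1, h2⟩
  rcases eq_or_ne I ∞ with hItop | hItop
  · refine ⟨E₀, hE₀m, Set.inter_eq_left.2 hE₀, fun F h1 h2 => ?_⟩
    have h3 := hIle F h1 h2
    rw [hItop, top_le_iff] at h3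
    exact h3 ▸ le_top
  suffices h : ∃ u : α → ℝ, AEMeasurable u μ ∧ (∀ x ∈ Ωᶜ, u x = E₀.indicator 1 x) ∧
      weightedVariation μ w u ≤ I by
    obtain ⟨u, hum, hu, huI⟩ := h
    obtain ⟨t, ht, hle⟩ := exists_superlevel_weightedVariation_le hw hum
    refine ⟨{x | t < u x}, nullMeasurableSet_lt aemeasurable_const hum, ?_,
      fun F h1 h2 => hle.trans (huI.trans (hIle F h1 h2))⟩
    -- Outside `Ω` the function is the indicator of `E₀`, so every level in `(0, 1)` returns exactly
    -- `E₀` there.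
    ext x
    constructor
    · rintro ⟨h1, h2⟩
      by_contra hx
      rw [Set.mem_ofPred_eq, hu x h2, Set.indicator_of_notMem hx] at h1
      linarith [ht.1]
    · intro hx
      refine ⟨?_, hE₀ hx⟩
      rw [Set.mem_ofPred_eq, hu x (hE₀ hx), Set.indicator_of_mem hx]
      exact ht.2
  set ext : (α → ℝ) → α → ℝ := fun f x => Ω.indicator f x + E₀.indicator 1 x with hext
  have hE₀ind : AEMeasurable (E₀.indicator (1 : α → ℝ)) μ :=
    (aemeasurable_indicator_const_iff (1 : ℝ)).2 hE₀m
  have hextm : ∀ f : Lp ℝ 2 (μ.restrict Ω), AEMeasurable (ext f) μ := fun f =>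
    ((aemeasurable_indicator_iff hΩ).2 (Lp.aestronglyMeasurable f).aemeasurable).add hE₀ind
  have hext_congr : ∀ f g : α → ℝ, f =ᵐ[μ.restrict Ω] g → ext f =ᵐ[μ] ext g := fun f g hfg => by
    filter_upwards [(ae_restrict_iff' hΩ).1 hfg] with x hx
    by_cases h : x ∈ Ω
    · simp [hext, h, hx h]
    · simp [hext, h]
  set C : ℕ → Set (Lp ℝ 2 (μ.restrict Ω)) := fun m =>
    {f | weightedVariation μ w (ext f) ≤ I + ((m : ℝ≥0∞) + 1)⁻¹} with hC
  have hfinite : IsFiniteMeasure (μ.restrict Ω) := ⟨by simpa using hΩfin⟩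
  have hanti : Antitone C := fun m k hmk f hf => by
    change weightedVariation μ w (ext f) ≤ _ at hf
    change weightedVariation μ w (ext f) ≤ _
    refine hf.trans ?_
    gcongr
  have hmid : ∀ m, ∀ f ∈ C m, ∀ g ∈ C m, (1 / 2 : ℝ) • (f + g) ∈ C m := by
    intro m f hf g hg
    have h1 : ext ((1 / 2 : ℝ) • (f + g) : Lp ℝ 2 (μ.restrict Ω)) =ᵐ[μ]
        fun x => 1 / 2 * (ext f x + ext g x) := by
      refine (hext_congr _ (fun x => 1 / 2 * (f x + g x)) ?_).trans (Eventually.of_forall ?_)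
      · filter_upwards [Lp.coeFn_smul (1 / 2 : ℝ) (f + g), Lp.coeFn_add f g] with x h1 h2
        rw [h1, Pi.smul_apply, h2, Pi.add_apply, smul_eq_mul]
      · intro x
        by_cases h : x ∈ Ω
        · have h0 : x ∉ E₀ := fun h' => hE₀ h' h
          simp [hext, h, h0]
        · simp only [hext, h, not_false_eq_true, Set.indicator_of_notMem]; ring
    change weightedVariation μ w _ ≤ _
    rw [weightedVariation_congr h1]
    exact weightedVariation_midpoint_le hw (hextm f) _ hf hg
  have hR : ∀ m, ∃ f ∈ C m, ‖f‖ ≤ (μ.restrict Ω).real Set.univ ^ (2 : ℝ≥0∞).toReal⁻¹ * 1 := by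
    intro m
    -- A nearly optimal set exists because `I` is finite; its indicator is bounded by 1 on `Ω`,
    -- which has finite measure, so the norm bound does not depend on `m`.
    have hlt : I < I + ((m : ℝ≥0∞) + 1)⁻¹ :=
      ENNReal.lt_add_right hItop (by simp)
    obtain ⟨⟨F, hF, hFE⟩, hFlt⟩ := iInf_lt_iff.1 hlt
    have hFm : AEStronglyMeasurable (F.indicator (1 : α → ℝ)) (μ.restrict Ω) :=
      (((aemeasurable_indicator_const_iff (1 : ℝ)).2 hF).aestronglyMeasurable).restrict
    have hbd : ∀ᵐ x ∂(μ.restrict Ω), ‖F.indicator (1 : α → ℝ) x‖ ≤ 1 :=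
        Eventually.of_forall fun x => by
      by_cases h : x ∈ F <;> simp [h]
    have hmem : MemLp (F.indicator (1 : α → ℝ)) 2 (μ.restrict Ω) := MemLp.of_bound hFm 1 hbd
    refine ⟨hmem.toLp, ?_, ?_⟩
    · have h1 : ext hmem.toLp =ᵐ[μ] F.indicator 1 := by
        refine (hext_congr _ _ hmem.coeFn_toLp).trans (Eventually.of_forall fun x => ?_)
        by_cases h : x ∈ Ω
        · have h0 : x ∉ E₀ := fun h' => hE₀ h' h
          simp [hext, h, h0]
        · have h0 : x ∈ E₀ ↔ x ∈ F := by rw [← hFE]; simp [h]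
          by_cases hx : x ∈ F <;> simp [hext, h, h0, hx]
      change weightedVariation μ w _ ≤ _
      rw [weightedVariation_congr h1]
      exact hFlt.le
    · refine Lp.norm_le_of_ae_bound zero_le_one ?_
      filter_upwards [hmem.coeFn_toLp, hbd] with x h1 h2
      rwa [h1]
  obtain ⟨v, hv, hcau⟩ := exists_cauchySeq_mem C hanti hmid _ hR
  obtain ⟨f, hf⟩ := cauchySeq_tendsto_of_complete hcau
  obtain ⟨ns, hns, hae⟩ := (tendstoInMeasure_of_tendsto_Lp hf).exists_seq_tendsto_ae
  refine ⟨ext f, hextm f, fun x hx => by simp [hext, Set.indicator_of_notMem hx], ?_⟩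
  refine weightedVariation_le_of_tendsto_ae hw (u := fun k => ext (v (ns k)))
    (fun k => hextm _) ?_ (fun k => hv (ns k)) ?_
  · filter_upwards [(ae_restrict_iff' hΩ).1 hae] with x hx
    by_cases h : x ∈ Ω
    · simpa [hext, h] using (hx h).add_const (E₀.indicator (1 : α → ℝ) x)
    · simp [hext, h]
  · have h1 : Tendsto (fun m : ℕ => I + ((m : ℝ≥0∞) + 1)⁻¹) atTop (𝓝 (I + 0)) := by
      refine Tendsto.const_add _ ?_
      have := (tendsto_add_atTop_iff_nat 1).2 ENNReal.tendsto_inv_nat_nhds_zero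
      simpa using this
    rw [add_zero] at h1
    exact h1.comp hns.tendsto_atTop

end WeightedVariation

/-! ### The perimeter as a weighted variation, and finiteness of the energy -/

variable {K : EuclideanSpace ℝ (Fin n) → ℝ}

theorem aemeasurable_of_integrable_mul_min (hn : 1 ≤ n)
    (hK : Integrable (fun z => K z * min 1 ‖z‖) volume) : AEMeasurable K volume := by
  have : Nonempty (Fin n) := ⟨⟨0, hn⟩⟩
  have h1 : AEMeasurable (fun z : V => K z * min 1 ‖z‖ / min 1 ‖z‖) volume :=
    hK.aestronglyMeasurable.aemeasurable.div (by fun_prop)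
  refine h1.congr ?_
  filter_upwards [compl_mem_ae_iff.2 (measure_singleton (μ := volume) (0 : V))] with z hz
  have h2 : 0 < min 1 ‖z‖ := lt_min one_pos (norm_pos_iff.2 hz)
  exact mul_div_cancel_right₀ _ h2.ne'

theorem aemeasurable_kernel_sub (hK : AEMeasurable K volume) :
    AEMeasurable (fun p : V × V => ENNReal.ofReal (K (p.1 - p.2))) (volume.prod volume) :=
  (hK.comp_quasiMeasurePreserving
    (quasiMeasurePreserving_sub_of_right_invariant volume volume)).ennreal_ofReal

theorem interaction_eq_lintegral_prod (hK : AEMeasurable K volume) {A B : Set V}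
    (hA : NullMeasurableSet A volume) (hB : NullMeasurableSet B volume) :
    interaction K A B = ∫⁻ p : V × V, (A ×ˢ B).indicator
      (fun p => ENNReal.ofReal (K (p.1 - p.2))) p ∂(volume.prod volume) := by
  rw [lintegral_indicator₀ (hA.prod hB),
    setLIntegral_prod _ (aemeasurable_kernel_sub hK).restrict]
  rfl

/-- The kernel `K(x - y)` restricted to the pairs `(x, y)` that meet `Ω`. -/
noncomputable def pairWeight (K : EuclideanSpace ℝ (Fin n) → ℝ)
    (Ω : Set (EuclideanSpace ℝ (Fin n))) :
    EuclideanSpace ℝ (Fin n) × EuclideanSpace ℝ (Fin n) → ℝ≥0∞ :=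
  (Ωᶜ ×ˢ Ωᶜ)ᶜ.indicator fun p => ENNReal.ofReal (K (p.1 - p.2))

theorem aemeasurable_pairWeight (hK : AEMeasurable K volume) {Ω : Set V} (hΩ : MeasurableSet Ω) :
    AEMeasurable (pairWeight K Ω) (volume.prod volume) :=
  (aemeasurable_kernel_sub hK).indicator (hΩ.compl.prod hΩ.compl).compl

theorem perimeter_eq_weightedVariation (hK : AEMeasurable K volume) {Ω E : Set V}
    (hΩ : MeasurableSet Ω) (hE : NullMeasurableSet E volume) :
    perimeter K Ω E = weightedVariation volume (pairWeight K Ω) (E.indicator 1) := by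
  have hΩ' : NullMeasurableSet Ω volume := hΩ.nullMeasurableSet
  have hmeas : ∀ {A B : Set V}, NullMeasurableSet A volume → NullMeasurableSet B volume →
      AEMeasurable ((A ×ˢ B).indicator fun p : V × V => ENNReal.ofReal (K (p.1 - p.2)))
        (volume.prod volume) := fun hA hB =>
    (aemeasurable_kernel_sub hK).indicator₀ (hA.prod hB)
  have m1 := hmeas (hE.inter hΩ') (hE.compl.inter hΩ')
  have m3 := hmeas (hE.diff hΩ') (hE.compl.inter hΩ')
  unfold perimeter weightedVariation
  rw [interaction_eq_lintegral_prod hK (hE.inter hΩ') (hE.compl.inter hΩ'),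
    interaction_eq_lintegral_prod hK (hE.inter hΩ') (hE.compl.diff hΩ'),
    interaction_eq_lintegral_prod hK (hE.diff hΩ') (hE.compl.inter hΩ'),
    ← lintegral_add_left' m1, ← lintegral_add_right' _ m3]
  refine lintegral_congr fun p => ?_
  -- Both sides count exactly the pairs with `x ∈ E`, `y ∉ E` that are not both outside `Ω`; the
  -- three interactions partition them.
  by_cases h1 : p.1 ∈ E <;> by_cases h2 : p.2 ∈ E <;> by_cases h3 : p.1 ∈ Ω <;>
    by_cases h4 : p.2 ∈ Ω <;> simp [pairWeight, Set.indicator, h1, h2, h3, h4]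

theorem interaction_mono {A A' B B' : Set V} (hA : A ⊆ A') (hB : B ⊆ B') :
    interaction K A B ≤ interaction K A' B' :=
  (lintegral_mono_set hA).trans (lintegral_mono fun _ => lintegral_mono_set hB)

/-- Substitute `x = y + z` and apply Tonelli; the inner integral becomes the measure bounded by
`volume_diff_translate_le`. -/
theorem interaction_compl_eq (hK : AEMeasurable K volume) {Ω : Set V} (hΩ : MeasurableSet Ω) :
    interaction K Ωᶜ Ω = ∫⁻ z, ENNReal.ofReal (K z) * volume {y | y ∈ Ω ∧ y + z ∉ Ω} := by
  rw [interaction_eq_lintegral_prod hK hΩ.compl.nullMeasurableSet hΩ.nullMeasurableSet,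
    lintegral_prod_symm _ ((aemeasurable_kernel_sub hK).indicator (hΩ.compl.prod hΩ))]
  have hset : MeasurableSet {q : V × V | q.1 ∈ Ω ∧ q.1 + q.2 ∉ Ω} :=
    (measurable_fst hΩ).inter ((measurable_fst.add measurable_snd) hΩ.compl)
  have h1 : ∀ y : V, ∫⁻ x, (Ωᶜ ×ˢ Ω).indicator
      (fun p : V × V => ENNReal.ofReal (K (p.1 - p.2))) (x, y) =
      ∫⁻ z, ENNReal.ofReal (K z) *
        {q : V × V | q.1 ∈ Ω ∧ q.1 + q.2 ∉ Ω}.indicator 1 (y, z) := fun y => by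
    rw [← lintegral_add_right_eq_self _ y]
    refine lintegral_congr fun z => ?_
    by_cases h1 : y ∈ Ω <;> by_cases h2 : z + y ∈ Ω <;>
      simp [Set.indicator, h1, h2, add_comm y z]
  simp_rw [h1]
  rw [lintegral_lintegral_swap]
  · refine lintegral_congr fun z => ?_
    have hz : MeasurableSet {y : V | y ∈ Ω ∧ y + z ∉ Ω} :=
      hΩ.inter ((measurable_id.add_const z) hΩ.compl)
    rw [← lintegral_indicator_one hz, ← lintegral_const_mul _ (measurable_one.indicator hz)]
    rfl
  · exact hK.ennreal_ofReal.comp_snd.mul (measurable_one.indicator hset).aemeasurable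

theorem interaction_compl_lt_top (hn : 1 ≤ n) {Ω : Set V} (hΩ : IsOpen Ω)
    (hbdd : Bornology.IsBounded Ω) (hlip : HasLipschitzBoundary Ω)
    (hK : Integrable (fun z => K z * min 1 ‖z‖) volume) : interaction K Ωᶜ Ω < ∞ := by
  obtain ⟨C, hC, hle⟩ := volume_diff_translate_le hbdd hlip
  rw [interaction_compl_eq (aemeasurable_of_integrable_mul_min hn hK) hΩ.measurableSet]
  calc ∫⁻ z, ENNReal.ofReal (K z) * volume {y | y ∈ Ω ∧ y + z ∉ Ω}
      ≤ ∫⁻ z, C * ENNReal.ofReal (K z * min 1 ‖z‖) := by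
        refine lintegral_mono fun z => ?_
        rw [ENNReal.ofReal_mul' (by positivity), mul_left_comm]
        gcongr
        simpa using hle (-z)
    _ = C * ∫⁻ z, ENNReal.ofReal (K z * min 1 ‖z‖) := lintegral_const_mul' _ _ hC
    _ < ∞ := ENNReal.mul_lt_top hC.lt_top hK.lintegral_lt_top

theorem perimeter_lt_top_of_subset_compl (hn : 1 ≤ n) {Ω : Set V} (hΩ : IsOpen Ω)
    (hbdd : Bornology.IsBounded Ω) (hlip : HasLipschitzBoundary Ω)
    (hK : Integrable (fun z => K z * min 1 ‖z‖) volume) {E : Set V} (hE : E ⊆ Ωᶜ) :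
    perimeter K Ω E < ∞ := by
  have h0 : E ∩ Ω = ∅ :=
    Set.disjoint_iff_inter_eq_empty.1 (Set.subset_compl_iff_disjoint_right.1 hE)
  have h1 : ∀ B : Set V, interaction K ∅ B = 0 := fun B => by simp [interaction]
  rw [perimeter, h0, h1, h1, zero_add, zero_add]
  exact (interaction_mono (Set.sdiff_subset.trans hE) Set.inter_subset_right).trans_lt
    (interaction_compl_lt_top hn hΩ hbdd hlip hK)

end NonlocalPerimeter

theorem theorem1p6 (n : ℕ) (hn : 1 ≤ n)
    (Ω : Set (EuclideanSpace ℝ (Fin n)))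
    (hΩ_open : IsOpen Ω) (hΩ_bdd : Bornology.IsBounded Ω)
    (hΩ_lip : NonlocalPerimeter.HasLipschitzBoundary Ω)
    (K : EuclideanSpace ℝ (Fin n) → ℝ) (hK : NonlocalPerimeter.IsAdmissibleKernel K)
    (E₀ : Set (EuclideanSpace ℝ (Fin n))) (hE₀ : E₀ ⊆ Ωᶜ)
    (hE₀_meas : NullMeasurableSet E₀ volume) :
    ∃ E : Set (EuclideanSpace ℝ (Fin n)),
      E ∩ Ωᶜ = E₀ ∧ NonlocalPerimeter.IsMinimizer K Ω E := by
  have hKm := NonlocalPerimeter.aemeasurable_of_integrable_mul_min hn hK.integrable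
  obtain ⟨E, hE, hEE₀, hmin⟩ := NonlocalPerimeter.exists_minimizer_weightedVariation
    (NonlocalPerimeter.aemeasurable_pairWeight hKm hΩ_open.measurableSet)
    hΩ_open.measurableSet hΩ_bdd.measure_lt_top hE₀ hE₀_meas
  have hle : ∀ F : Set (EuclideanSpace ℝ (Fin n)), NullMeasurableSet F volume → F ∩ Ωᶜ = E₀ →
      NonlocalPerimeter.perimeter K Ω E ≤ NonlocalPerimeter.perimeter K Ω F := by
    intro F hF hFE₀
    rw [NonlocalPerimeter.perimeter_eq_weightedVariation hKm hΩ_open.measurableSet hE,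
      NonlocalPerimeter.perimeter_eq_weightedVariation hKm hΩ_open.measurableSet hF]
    exact hmin F hF hFE₀
  refine ⟨E, hEE₀, hE, ?_, fun F hF hFE => hle F hF ?_⟩
  · exact (hle E₀ hE₀_meas (Set.inter_eq_left.2 hE₀)).trans_lt
      (NonlocalPerimeter.perimeter_lt_top_of_subset_compl hn hΩ_open hΩ_bdd hΩ_lip
        hK.integrable hE₀)
  · rw [← Set.sdiff_eq, hFE, Set.sdiff_eq, hEE₀]
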